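/- Let $R$ be an associative ring with unity and let $n \ge 0$ be an integer. Assume that $R$ is right coherent (every finitely generated right ideal of $R$ is finitely presented) and left $n$-perfect (every flat left $R$-module has projective dimension at most $n$). Call an exact complex $C = (\cdots \to C_{i+1} \to C_i \to C_{i-1} \to \cdots)$, $i \in \mathbb{Z}$, of flat left $R$-modules N-totally acyclic if the complex of abelian groups $E \otimes_R C$ is exact for every injective right $R$-module $E$, and call an exact complex $C$ of projective left $R$-modules totally acyclic if the complex of abelian groups $\operatorname{Hom}_R(C, P)$ is exact for every projective left $R$-module $P$. Then every N-totally acyclic complex of projective left $R$-modules is totally acyclic. -/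

import Mathlib

open CategoryTheory
open scoped TensorProduct

universe u

/-- The subgroup of `E ⊗_ℤ M` generated by the elements `(e · r) ⊗ m - e ⊗ (r • m)`; here `E` is a
right `R`-module (a module over `Rᵐᵒᵖ`) and `M` is a left `R`-module. -/
def balancedRel (R : Type u) [Ring R] (E : Type u) [AddCommGroup E] [Module Rᵐᵒᵖ E]
    (M : Type u) [AddCommGroup M] [Module R M] : Submodule ℤ (E ⊗[ℤ] M) :=
  Submodule.span ℤ {t | ∃ (e : E) (r : R) (m : M),
    t = (MulOpposite.op r • e) ⊗ₜ[ℤ] m - e ⊗ₜ[ℤ] (r • m)}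

/-- The tensor product `E ⊗_R M` of a right `R`-module and a left `R`-module over a not necessarily
commutative ring, an abelian group. -/
abbrev BalancedTensor (R : Type u) [Ring R] (E : Type u) [AddCommGroup E] [Module Rᵐᵒᵖ E]
    (M : Type u) [AddCommGroup M] [Module R M] : Type u :=
  (E ⊗[ℤ] M) ⧸ balancedRel R E M

theorem balancedRel_le_comap (R : Type u) [Ring R]
    {E E' : Type u} [AddCommGroup E] [Module Rᵐᵒᵖ E] [AddCommGroup E'] [Module Rᵐᵒᵖ E']
    {M M' : Type u} [AddCommGroup M] [Module R M] [AddCommGroup M'] [Module R M']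
    (f : E →ₗ[Rᵐᵒᵖ] E') (g : M →ₗ[R] M') :
    balancedRel R E M ≤ (balancedRel R E' M').comap
      (TensorProduct.map f.toAddMonoidHom.toIntLinearMap g.toAddMonoidHom.toIntLinearMap) := by
  refine Submodule.span_le.2 ?_
  rintro t ⟨e, r, m, rfl⟩
  refine Submodule.subset_span ⟨f e, r, g m, ?_⟩
  simp

/-- The map `f ⊗ g : E ⊗_R M → E' ⊗_R M'`. -/
def BalancedTensor.map (R : Type u) [Ring R]
    {E E' : Type u} [AddCommGroup E] [Module Rᵐᵒᵖ E] [AddCommGroup E'] [Module Rᵐᵒᵖ E']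
    {M M' : Type u} [AddCommGroup M] [Module R M] [AddCommGroup M'] [Module R M']
    (f : E →ₗ[Rᵐᵒᵖ] E') (g : M →ₗ[R] M') :
    BalancedTensor R E M →ₗ[ℤ] BalancedTensor R E' M' :=
  Submodule.mapQ _ _
    (TensorProduct.map f.toAddMonoidHom.toIntLinearMap g.toAddMonoidHom.toIntLinearMap)
    (balancedRel_le_comap R f g)

theorem BalancedTensor.hom_ext (R : Type u) [Ring R]
    {E : Type u} [AddCommGroup E] [Module Rᵐᵒᵖ E] {M : Type u} [AddCommGroup M] [Module R M]
    {A : Type u} [AddCommGroup A] (p q : BalancedTensor R E M →ₗ[ℤ] A)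
    (h : ∀ (e : E) (m : M), p (Submodule.Quotient.mk (e ⊗ₜ[ℤ] m)) =
      q (Submodule.Quotient.mk (e ⊗ₜ[ℤ] m))) : p = q := by
  refine Submodule.linearMap_qext _ (TensorProduct.ext' fun e m => ?_)
  exact h e m

/-- The functor `E ⊗_R -` from left `R`-modules to abelian groups. -/
def balancedTensorFunctor (R : Type u) [Ring R] (E : Type u) [AddCommGroup E] [Module Rᵐᵒᵖ E] :
    ModuleCat.{u} R ⥤ ModuleCat.{u} ℤ where
  obj M := ModuleCat.of ℤ (BalancedTensor R E M)
  map g := ModuleCat.ofHom (BalancedTensor.map R (LinearMap.id : E →ₗ[Rᵐᵒᵖ] E) g.hom)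
  map_id M := by
    refine ModuleCat.hom_ext (BalancedTensor.hom_ext R _ _ fun e m => ?_)
    rfl
  map_comp g h := by
    refine ModuleCat.hom_ext (BalancedTensor.hom_ext R _ _ fun e m => ?_)
    rfl

instance balancedTensorFunctor_additive (R : Type u) [Ring R] (E : Type u) [AddCommGroup E]
    [Module Rᵐᵒᵖ E] : (balancedTensorFunctor R E).Additive where
  map_add {M N g h} := by
    refine ModuleCat.hom_ext (BalancedTensor.hom_ext R _ _ fun e m => ?_)
    change (balancedRel R E N).mkQ (e ⊗ₜ[ℤ] (g.hom m + h.hom m)) =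
      (balancedRel R E N).mkQ (e ⊗ₜ[ℤ] g.hom m) + (balancedRel R E N).mkQ (e ⊗ₜ[ℤ] h.hom m)
    rw [TensorProduct.tmul_add, map_add]

/-- A left `R`-module `M` is flat if `- ⊗_R M` preserves injectivity of maps of right modules. -/
def IsFlatModule (R : Type u) [Ring R] (M : Type u) [AddCommGroup M] [Module R M] : Prop :=
  ∀ (E E' : Type u) [AddCommGroup E] [Module Rᵐᵒᵖ E] [AddCommGroup E'] [Module Rᵐᵒᵖ E']
    (f : E →ₗ[Rᵐᵒᵖ] E'), Function.Injective f →
    Function.Injective (BalancedTensor.map R f (LinearMap.id : M →ₗ[R] M))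

/-- `R` is right coherent: every finitely generated right ideal is finitely presented as a right
`R`-module. -/
def IsRightCoherent (R : Type u) [Ring R] : Prop :=
  ∀ I : Submodule Rᵐᵒᵖ R, I.FG → Module.FinitePresentation Rᵐᵒᵖ I

/-- `R` is left `n`-perfect: every flat left `R`-module has projective dimension at most `n`. -/
def IsLeftNPerfect (R : Type u) [Ring R] (n : ℕ) : Prop :=
  ∀ F : ModuleCat.{u} R, IsFlatModule R F → HasProjectiveDimensionLE F n

/-- The complex of abelian groups `E ⊗_R C`. -/
noncomputable def tensorComplex {R : Type u} [Ring R] (E : Type u) [AddCommGroup E] [Module Rᵐᵒᵖ E]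
    (C : ChainComplex (ModuleCat.{u} R) ℤ) : ChainComplex (ModuleCat.{u} ℤ) ℤ :=
  ((balancedTensorFunctor R E).mapHomologicalComplex _).obj C

/-- The complex of abelian groups `Hom_R(C, P)`, which has `Hom_R(C_i, P)` in degree `i` and
differentials given by precomposition with those of `C`. -/
noncomputable def homComplex {R : Type u} [Ring R] (C : ChainComplex (ModuleCat.{u} R) ℤ)
    (P : ModuleCat.{u} R) : HomologicalComplex AddCommGrpCat.{u} (ComplexShape.down ℤ).symm :=
  ((preadditiveYoneda.obj P).mapHomologicalComplex _).obj C.op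

/-- An exact complex `C` of flat left `R`-modules is N-totally acyclic if `E ⊗_R C` is exact for
every injective right `R`-module `E`. -/
structure IsNTotallyAcyclic {R : Type u} [Ring R] (C : ChainComplex (ModuleCat.{u} R) ℤ) :
    Prop where
  flat : ∀ i : ℤ, IsFlatModule R (C.X i)
  exact : C.Acyclic
  tensor_exact : ∀ (E : Type u) [AddCommGroup E] [Module Rᵐᵒᵖ E], Module.Injective Rᵐᵒᵖ E →
    (tensorComplex E C).Acyclic

/-- An exact complex `C` of projective left `R`-modules is totally acyclic if `Hom_R(C, P)` is exact
for every projective left `R`-module `P`. -/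
structure IsTotallyAcyclic {R : Type u} [Ring R] (C : ChainComplex (ModuleCat.{u} R) ℤ) :
    Prop where
  projective : ∀ i : ℤ, Module.Projective R (C.X i)
  exact : C.Acyclic
  hom_exact : ∀ P : ModuleCat.{u} R, Module.Projective R P → (homComplex C P).Acyclic

/-! Write `M⁺` for the character module of `M` with values in `ℚ/ℤ`. Since `Hom(C, E⁺)` is the dual
of `E ⊗ C`, N-total acyclicity makes `Hom(C, E⁺)` exact for every injective right module `E`. The
task is to pass from such modules `E⁺` to a projective `P`.

If `P` is projective then `P⁺` is injective. Right coherence says that `E⁺⁺` is injective whenever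
`E` is. The sequence `0 → M → M⁺⁺ → M⁺⁺/M → 0` is pure, so its cokernel again has injective
character module when `M` does. Iterating gives a coresolution of `P` by `Hom(C, -)`-acyclic modules
`F m = (X m)⁺⁺`, with all cosyzygies `X m` flat, so `X (n + 1)` has projective dimension at most
`n`.

Resolving `X (n + 1)` by projectives and asking these to be acyclic would be circular. Instead, a
map to `X (m + 1)` from an object of projective dimension at most `m` is compared with the
coresolution: dimension shifting on both sides reduces it to a map from a projective, which factors
through `F 0` and so is zero on cohomology. For the identity of `X (n + 1)` this gives acyclicity,
which then descends to `X 0 = P`. -/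

/-- Additive maps into `ℚ/ℤ` extend along arbitrary additive maps, as soon as kernels permit. -/
theorem exists_character_comp_eq {A B : Type u} [AddCommGroup A] [AddCommGroup B]
    (f : A →+ B) (φ : A →+ AddCircle (1 : ℚ)) (h : ∀ a, f a = 0 → φ a = 0) :
    ∃ ψ : B →+ AddCircle (1 : ℚ), ∀ a, ψ (f a) = φ a := by
  let e : A ⧸ f.ker →+ B := QuotientAddGroup.kerLift f
  let φ' : A ⧸ f.ker →+ AddCircle (1 : ℚ) :=
    QuotientAddGroup.lift f.ker φ (fun a ha => h a ha)
  obtain ⟨ψ, hψ⟩ := (Module.Baer.of_divisible (AddCircle (1 : ℚ))).extension_property_addMonoidHom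
    e (QuotientAddGroup.kerLift_injective f) φ'
  exact ⟨ψ, fun a => DFunLike.congr_fun hψ (a : A ⧸ f.ker)⟩

theorem eq_zero_of_forall_character {A : Type u} [AddCommGroup A] (a : A)
    (h : ∀ ψ : A →+ AddCircle (1 : ℚ), ψ a = 0) : a = 0 :=
  CharacterModule.eq_zero_of_character_apply fun c => h c

/-! ### Character modules and their duality with the tensor product -/

/-- The character module of a left module, a right module. -/
def LeftCharacter (R : Type u) [Ring R] (M : Type u) [AddCommGroup M] [Module R M] : Type u :=
  M →+ AddCircle (1 : ℚ)

/-- The character module of a right module, a left module. -/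
def RightCharacter (R : Type u) [Ring R] (E : Type u) [AddCommGroup E] [Module Rᵐᵒᵖ E] : Type u :=
  E →+ AddCircle (1 : ℚ)

section Characters

variable {R : Type u} [Ring R]
variable {M N : Type u} [AddCommGroup M] [Module R M] [AddCommGroup N] [Module R N]
variable {E E' : Type u} [AddCommGroup E] [Module Rᵐᵒᵖ E] [AddCommGroup E'] [Module Rᵐᵒᵖ E']

instance : AddCommGroup (LeftCharacter R M) := inferInstanceAs (AddCommGroup (M →+ _))

instance : AddCommGroup (RightCharacter R E) := inferInstanceAs (AddCommGroup (E →+ _))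

instance : FunLike (LeftCharacter R M) M (AddCircle (1 : ℚ)) :=
  inferInstanceAs (FunLike (M →+ AddCircle (1 : ℚ)) M (AddCircle (1 : ℚ)))

instance : FunLike (RightCharacter R E) E (AddCircle (1 : ℚ)) :=
  inferInstanceAs (FunLike (E →+ AddCircle (1 : ℚ)) E (AddCircle (1 : ℚ)))

instance : AddMonoidHomClass (LeftCharacter R M) M (AddCircle (1 : ℚ)) :=
  inferInstanceAs (AddMonoidHomClass (M →+ AddCircle (1 : ℚ)) M (AddCircle (1 : ℚ)))

instance : AddMonoidHomClass (RightCharacter R E) E (AddCircle (1 : ℚ)) :=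
  inferInstanceAs (AddMonoidHomClass (E →+ AddCircle (1 : ℚ)) E (AddCircle (1 : ℚ)))

@[ext] theorem LeftCharacter.ext {f g : LeftCharacter R M} (h : ∀ x, f x = g x) : f = g :=
  DFunLike.ext _ _ h

@[ext] theorem RightCharacter.ext {f g : RightCharacter R E} (h : ∀ x, f x = g x) : f = g :=
  DFunLike.ext _ _ h

@[simp] theorem LeftCharacter.add_apply (f g : LeftCharacter R M) (x : M) :
    (f + g) x = f x + g x := rfl

@[simp] theorem RightCharacter.add_apply (f g : RightCharacter R E) (x : E) :
    (f + g) x = f x + g x := rfl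

theorem RightCharacter.sum_apply {ι : Type*} (s : Finset ι) (f : ι → RightCharacter R E) (x : E) :
    (∑ i ∈ s, f i) x = ∑ i ∈ s, f i x :=
  AddMonoidHom.finsetSum_apply (M := E) (N := AddCircle (1 : ℚ)) f s x

theorem LeftCharacter.sum_apply {ι : Type*} (s : Finset ι) (f : ι → LeftCharacter R M) (x : M) :
    (∑ i ∈ s, f i) x = ∑ i ∈ s, f i x :=
  AddMonoidHom.finsetSum_apply (M := M) (N := AddCircle (1 : ℚ)) f s x

instance : Module Rᵐᵒᵖ (LeftCharacter R M) where
  smul r f := (f : M →+ AddCircle (1 : ℚ)).comp (DistribSMul.toAddMonoidHom M r.unop)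
  one_smul f := LeftCharacter.ext fun x => congrArg f (one_smul R x)
  mul_smul r s f := LeftCharacter.ext fun x => congrArg f (mul_smul s.unop r.unop x)
  smul_zero _ := rfl
  smul_add _ _ _ := rfl
  add_smul r s f := LeftCharacter.ext fun x =>
    (congrArg f (add_smul r.unop s.unop x)).trans (map_add f _ _)
  zero_smul f := LeftCharacter.ext fun x => (congrArg f (zero_smul R x)).trans (map_zero f)

instance : Module R (RightCharacter R E) where
  smul r f := (f : E →+ AddCircle (1 : ℚ)).comp (DistribSMul.toAddMonoidHom E (MulOpposite.op r))
  one_smul f := RightCharacter.ext fun x => congrArg f (one_smul Rᵐᵒᵖ x)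
  mul_smul r s f := RightCharacter.ext fun x =>
    congrArg f (mul_smul (MulOpposite.op s) (MulOpposite.op r) x)
  smul_zero _ := rfl
  smul_add _ _ _ := rfl
  add_smul r s f := RightCharacter.ext fun x =>
    (congrArg f (add_smul (MulOpposite.op r) (MulOpposite.op s) x)).trans (map_add f _ _)
  zero_smul f := RightCharacter.ext fun x => (congrArg f (zero_smul Rᵐᵒᵖ x)).trans (map_zero f)

/-- Precomposition with a linear map of left modules. -/
def LeftCharacter.map (g : M →ₗ[R] N) : LeftCharacter R N →ₗ[Rᵐᵒᵖ] LeftCharacter R M where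
  toFun f := (f : N →+ AddCircle (1 : ℚ)).comp g.toAddMonoidHom
  map_add' _ _ := rfl
  map_smul' r f := LeftCharacter.ext fun x => congrArg f (map_smul g r.unop x).symm

/-- Precomposition with a linear map of right modules. -/
def RightCharacter.map (g : E →ₗ[Rᵐᵒᵖ] E') : RightCharacter R E' →ₗ[R] RightCharacter R E where
  toFun f := (f : E' →+ AddCircle (1 : ℚ)).comp g.toAddMonoidHom
  map_add' _ _ := rfl
  map_smul' r f := RightCharacter.ext fun x => congrArg f (map_smul g (MulOpposite.op r) x).symm

/-- Divisibility of `ℚ/ℤ` makes duality exact; this converts extension problems for maps into `M⁺`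
into lifting problems for maps out of `M`. -/
theorem RightCharacter.map_surjective (g : E →ₗ[Rᵐᵒᵖ] E') (hg : Function.Injective g) :
    Function.Surjective (RightCharacter.map g) := fun f => by
  obtain ⟨ψ, hψ⟩ := exists_character_comp_eq g.toAddMonoidHom (f : E →+ AddCircle (1 : ℚ))
    (fun a ha => (congrArg f (hg (ha.trans (map_zero g).symm))).trans (map_zero f))
  exact ⟨ψ, RightCharacter.ext hψ⟩

/-- Exchange of variables, from right linear maps `E → M⁺` to left linear maps `M → E⁺`. -/
def LeftCharacter.swap (g : E →ₗ[Rᵐᵒᵖ] LeftCharacter R M) : M →ₗ[R] RightCharacter R E where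
  toFun m := (AddMonoidHom.mk' (fun e => g e m) fun a b => by simp : E →+ AddCircle (1 : ℚ))
  map_add' a b := RightCharacter.ext fun e => map_add (g e) a b
  map_smul' r a := RightCharacter.ext fun e =>
    (DFunLike.congr_fun (map_smul g (MulOpposite.op r) e) a).symm

/-- Exchange of variables, from left linear maps `M → E⁺` to right linear maps `E → M⁺`. -/
def RightCharacter.swap (g : M →ₗ[R] RightCharacter R E) : E →ₗ[Rᵐᵒᵖ] LeftCharacter R M where
  toFun e := (AddMonoidHom.mk' (fun m => g m e) fun a b => by simp : M →+ AddCircle (1 : ℚ))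
  map_add' a b := LeftCharacter.ext fun m => map_add (g m) a b
  map_smul' r e := LeftCharacter.ext fun m =>
    (DFunLike.congr_fun (map_smul g r.unop m) e).symm

variable (R M) in
/-- Evaluation, from a left module to its double character module. -/
def LeftCharacter.eval : M →ₗ[R] RightCharacter R (LeftCharacter R M) :=
  LeftCharacter.swap LinearMap.id

theorem LeftCharacter.eval_injective : Function.Injective (LeftCharacter.eval R M) :=
  (injective_iff_map_eq_zero _).2 fun m hm =>
    eq_zero_of_forall_character m fun ψ => DFunLike.congr_fun hm ψ

/-- The biadditive pairing `E × M → ℚ/ℤ` defined by a linear map `M → E⁺`. -/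
def RightCharacter.pairing (g : M →ₗ[R] RightCharacter R E) :
    E ⊗[ℤ] M →ₗ[ℤ] AddCircle (1 : ℚ) :=
  TensorProduct.lift (LinearMap.mk₂ ℤ (fun (e : E) (m : M) => g m e)
    (fun a b m => map_add (g m) a b) (fun c e m => map_zsmul (g m) c e)
    (fun e a b => map_add (RightCharacter.swap g e) a b)
    (fun c e m => map_zsmul (RightCharacter.swap g e) c m))

/-- The additive map on `E ⊗_R M` defined by a linear map `M → E⁺`. -/
def BalancedTensor.character (g : M →ₗ[R] RightCharacter R E) :
    BalancedTensor R E M →+ AddCircle (1 : ℚ) :=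
  ((balancedRel R E M).liftQ (RightCharacter.pairing g)
    (Submodule.span_le.2 (by
      rintro t ⟨e, r, m, rfl⟩
      change RightCharacter.pairing g _ = 0
      exact (map_sub _ _ _).trans
        (sub_eq_zero.2 (DFunLike.congr_fun (map_smul g r m) e).symm)))).toAddMonoidHom

/-- The linear map `M → E⁺` defined by an additive map on `E ⊗_R M`. -/
def BalancedTensor.curry (ψ : BalancedTensor R E M →+ AddCircle (1 : ℚ)) :
    M →ₗ[R] RightCharacter R E where
  toFun m := AddMonoidHom.mk' (fun e => ψ ((balancedRel R E M).mkQ (e ⊗ₜ[ℤ] m)))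
    fun a b => by rw [TensorProduct.add_tmul, map_add, map_add]
  map_add' a b := RightCharacter.ext fun e => by
    change ψ ((balancedRel R E M).mkQ (e ⊗ₜ[ℤ] (a + b))) = _
    rw [TensorProduct.tmul_add, map_add, map_add]
    rfl
  map_smul' r a := RightCharacter.ext fun e => by
    refine congrArg ψ (Eq.symm ?_)
    exact (Submodule.Quotient.eq _).2 (Submodule.subset_span ⟨e, r, a, rfl⟩)

/-! ### Injectivity and flatness under duality -/

/-- The character module of a projective module is injective. -/
theorem injective_leftCharacter_of_projective [Module.Projective R M] :
    Module.Injective Rᵐᵒᵖ (LeftCharacter R M) where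
  out E E' _ _ _ _ f hf g := by
    obtain ⟨h, hh⟩ := Module.projective_lifting_property (RightCharacter.map f)
      (LeftCharacter.swap g) (RightCharacter.map_surjective f hf)
    refine ⟨RightCharacter.swap h, fun x => LeftCharacter.ext fun m => ?_⟩
    exact DFunLike.congr_fun (LinearMap.congr_fun hh m) x

/-- A module with injective character module is flat. -/
theorem isFlatModule_of_injective_leftCharacter
    (h : Module.Injective Rᵐᵒᵖ (LeftCharacter R M)) : IsFlatModule R M := by
  intro E E' _ _ _ _ f hf
  refine (injective_iff_map_eq_zero _).2 fun x hx => eq_zero_of_forall_character x fun ψ => ?_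
  -- By adjunction `ψ` is a map `E → M⁺`; its extension `k` to `E'` factors `ψ` through the tensored
  -- map, so `ψ` kills `x`.
  obtain ⟨k, hk⟩ := h.out f hf (RightCharacter.swap (BalancedTensor.curry ψ))
  have key : ((BalancedTensor.character (LeftCharacter.swap k)).toIntLinearMap.comp
      (BalancedTensor.map R f (LinearMap.id : M →ₗ[R] M))).toAddMonoidHom = ψ := by
    ext x
    obtain ⟨t, rfl⟩ := Submodule.Quotient.mk_surjective _ x
    induction t with
    | zero => exact (map_zero _).trans (map_zero ψ).symm
    | add a b ha hb => exact (map_add _ _ _).trans ((congrArg₂ _ ha hb).trans (map_add ψ _ _).symm)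
    | tmul e m => exact DFunLike.congr_fun (hk e) m
  rw [← key]
  exact (congrArg _ hx).trans (map_zero _)

/-- If `M⁺⁺` has injective character module, so does the cokernel of `M → M⁺⁺`. -/
theorem injective_leftCharacter_quotient_eval
    (h : Module.Injective Rᵐᵒᵖ (LeftCharacter R (RightCharacter R (LeftCharacter R M)))) :
    Module.Injective Rᵐᵒᵖ (LeftCharacter R
      (RightCharacter R (LeftCharacter R M) ⧸ LinearMap.range (LeftCharacter.eval R M))) where
  out E E' _ _ _ _ f hf g := by
    let N := LinearMap.range (LeftCharacter.eval R M)
    obtain ⟨k, hk⟩ := h.out f hf ((LeftCharacter.map N.mkQ).comp g)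
    -- Subtract the component of `k` that does not vanish on the image of `M`.
    let k' := k - (RightCharacter.swap LinearMap.id).comp
      ((LeftCharacter.map (LeftCharacter.eval R M)).comp k)
    have hk' : ∀ x, ∀ y ∈ N, k' x y = 0 := by
      rintro x _ ⟨m, rfl⟩
      exact sub_self (k x (LeftCharacter.eval R M m))
    refine ⟨RightCharacter.swap (N.liftQ (LeftCharacter.swap k') fun y hy =>
      RightCharacter.ext fun x => hk' x y hy), fun x => LeftCharacter.ext fun q => ?_⟩
    obtain ⟨y, rfl⟩ := N.mkQ_surjective q
    change k' (f x) y = g x (N.mkQ y)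
    -- The correction vanishes on the image of `f`: there `k` agrees with `g`, whose values are
    -- characters killing the image of `M`. Hence `k'` still extends `g`.
    have h1 : LeftCharacter.map (LeftCharacter.eval R M) (k (f x)) = 0 := by
      ext m
      rw [hk]
      change g x (N.mkQ (LeftCharacter.eval R M m)) = 0
      rw [(Submodule.Quotient.mk_eq_zero N).2 ⟨m, rfl⟩ |> fun h : N.mkQ _ = 0 => h, map_zero]
    change k (f x) y - y (LeftCharacter.map (LeftCharacter.eval R M) (k (f x))) = _
    rw [h1, map_zero, sub_zero, hk]
    rfl

/-! ### Consequences of right coherence -/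

/-- The equational criterion for `E⁺`, when `E` is injective and the ring is right coherent. -/
theorem exists_relations_of_sum_smul_eq_zero (hcoh : IsRightCoherent R)
    (hE : Module.Injective Rᵐᵒᵖ E) {ι : Type u} [Fintype ι] (a : ι → R)
    (m : ι → RightCharacter R E) (h : ∑ i, a i • m i = 0) :
    ∃ (s : Finset (ι → Rᵐᵒᵖ)) (y : s → RightCharacter R E),
      (∀ c ∈ s, ∑ i, c i • a i = 0) ∧ ∀ i, m i = ∑ c : s, (c.1 i).unop • y c := by
  classical
  let I : Submodule Rᵐᵒᵖ R := Submodule.span Rᵐᵒᵖ (Set.range a)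
  have hfp : Module.FinitePresentation Rᵐᵒᵖ I :=
    hcoh I (Submodule.fg_span (Set.finite_range a))
  let b : ι → I := fun i => ⟨a i, Submodule.subset_span ⟨i, rfl⟩⟩
  let l : (ι → Rᵐᵒᵖ) →ₗ[Rᵐᵒᵖ] I := Fintype.linearCombination Rᵐᵒᵖ b
  have hl_apply : ∀ c, ((l c : I) : R) = ∑ i, c i • a i := fun c => by
    simp [l, b, Fintype.linearCombination_apply]
  have hl : Function.Surjective l := by
    rintro ⟨x, hx⟩
    obtain ⟨c, hc⟩ := (Submodule.mem_span_range_iff_exists_fun Rᵐᵒᵖ).1 hx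
    exact ⟨c, Subtype.ext ((hl_apply c).trans hc)⟩
  -- Coherence enters here: finitely many relations `s` generate all relations among the `a i`. The
  -- `y c` will be the components of an extension of `φ` along `ρ`.
  obtain ⟨s, hs⟩ := Module.FinitePresentation.fg_ker l hl
  have hsl : ∀ c ∈ s, l c = 0 := fun c hc => by
    have : c ∈ LinearMap.ker l := hs ▸ Submodule.subset_span hc
    exact this
  let ρ : (ι → E) →+ (s → E) := AddMonoidHom.mk' (fun e c => ∑ i, c.1 i • e i) fun u v => by
    ext c
    simp [Finset.sum_add_distrib]
  let φ : (ι → E) →+ AddCircle (1 : ℚ) := AddMonoidHom.mk' (fun e => ∑ i, m i (e i)) fun u v => by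
    simp [Finset.sum_add_distrib]
  have hφ : ∀ e, ρ e = 0 → φ e = 0 := fun e he => by
    -- A tuple in the kernel of `ρ` satisfies every relation among the `a i`, so it defines a map `I
    -- → E`. Injectivity extends this to the whole ring, whence `e i` is `w 1` times `a i`.
    let t : (ι → Rᵐᵒᵖ) →ₗ[Rᵐᵒᵖ] E := Fintype.linearCombination Rᵐᵒᵖ e
    have ht : LinearMap.ker l ≤ LinearMap.ker t := by
      rw [← hs, Submodule.span_le]
      exact fun c hc => (Fintype.linearCombination_apply Rᵐᵒᵖ e c).trans (congrFun he ⟨c, hc⟩)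
    let q : I →ₗ[Rᵐᵒᵖ] E :=
      ((LinearMap.ker l).liftQ t ht).comp (l.quotKerEquivOfSurjective hl).symm.toLinearMap
    have hq : ∀ c, q (l c) = t c := fun c => by
      have : (l.quotKerEquivOfSurjective hl).symm (l c) = (LinearMap.ker l).mkQ c := by
        rw [LinearEquiv.symm_apply_eq]; rfl
      change (LinearMap.ker l).liftQ t ht ((l.quotKerEquivOfSurjective hl).symm (l c)) = _
      rw [this]; rfl
    obtain ⟨w, hw⟩ := hE.out I.subtype I.injective_subtype q
    have he' : ∀ i, e i = MulOpposite.op (a i) • w 1 := fun i => by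
      have h1 := hq (Pi.single i 1)
      rw [← hw] at h1
      have h2 : ((l (Pi.single i 1) : I) : R) = MulOpposite.op (a i) • (1 : R) := by
        simp [l, b]
      rw [Submodule.subtype_apply, h2, map_smul] at h1
      simpa [t] using h1.symm
    calc φ e = ∑ i, (a i • m i) (w 1) := Finset.sum_congr rfl fun i _ => by rw [he']; rfl
      _ = 0 := by rw [← RightCharacter.sum_apply, h]; rfl
  obtain ⟨ψ, hψ⟩ := exists_character_comp_eq ρ φ hφ
  refine ⟨s, fun c => ψ.comp (AddMonoidHom.single (fun _ => E) c), fun c hc => ?_,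
    fun i => RightCharacter.ext fun e => ?_⟩
  · rw [← hl_apply, hsl c hc]; rfl
  · have h1 := hψ (Pi.single i e)
    have h2 : φ (Pi.single i e) = m i e := by
      change ∑ j, m j ((Pi.single i e : ι → E) j) = _
      rw [Finset.sum_eq_single i]
      · rw [Pi.single_eq_same]
      · intro j _ hj; rw [Pi.single_eq_of_ne hj, map_zero]
      · simp
    have h3 : ρ (Pi.single i e) = ∑ c : s, Pi.single c (c.1 i • e) := by
      rw [Finset.univ_sum_single]
      funext c
      change ∑ j, c.1 j • (Pi.single i e : ι → E) j = _
      rw [Finset.sum_eq_single i]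
      · rw [Pi.single_eq_same]
      · intro j _ hj; rw [Pi.single_eq_of_ne hj, smul_zero]
      · simp
    rw [← h2, ← h1, h3, map_sum, RightCharacter.sum_apply]
    rfl

/-- Over a right coherent ring, the character module of an injective right module is flat. -/
theorem injective_leftCharacter_rightCharacter (hcoh : IsRightCoherent R)
    (hE : Module.Injective Rᵐᵒᵖ E) :
    Module.Injective Rᵐᵒᵖ (LeftCharacter R (RightCharacter R E)) := by
  refine Module.Baer.injective fun I g => ?_
  -- A Baer extension of `g` is a character of `E⁺` inducing `φ` through multiplication `μ`. It
  -- exists once `ker μ ≤ ker φ`, which is where the equational criterion is used; tensoring over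
  -- `ℤ` suffices, as this inclusion also covers the balancing relations.
  let μ : I ⊗[ℤ] RightCharacter R E →ₗ[ℤ] RightCharacter R E :=
    TensorProduct.lift (LinearMap.mk₂ ℤ
      (fun (r : I) (m : RightCharacter R E) => (r : Rᵐᵒᵖ).unop • m)
      (fun a b m => add_smul _ _ m) (fun c r m => smul_assoc c (r : Rᵐᵒᵖ).unop m)
      (fun r a b => smul_add _ a b) (fun c r m => smul_comm _ c m))
  let φ : I ⊗[ℤ] RightCharacter R E →ₗ[ℤ] AddCircle (1 : ℚ) :=
    TensorProduct.lift (LinearMap.mk₂ ℤ (fun (r : I) (m : RightCharacter R E) => g r m)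
      (fun a b m => by rw [map_add]; rfl)
      (fun c r m => DFunLike.congr_fun (map_zsmul g c r) m)
      (fun r a b => map_add (g r) a b) (fun c r m => map_zsmul (g r) c m))
  have hker : ∀ t, μ.toAddMonoidHom t = 0 → φ.toAddMonoidHom t = 0 := fun t ht => by
    obtain ⟨S, rfl⟩ := TensorProduct.exists_finset t
    have h0 : ∑ p : S, (p.1.1 : Rᵐᵒᵖ).unop • p.1.2 = 0 := by
      rw [Finset.sum_coe_sort S fun p => (p.1 : Rᵐᵒᵖ).unop • p.2]
      rw [map_sum] at ht
      exact ht
    obtain ⟨s, y, hs, hy⟩ := exists_relations_of_sum_smul_eq_zero hcoh hE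
      (fun p : S => (p.1.1 : Rᵐᵒᵖ).unop) (fun p => p.1.2) h0
    have h1 : φ.toAddMonoidHom (∑ p ∈ S, p.1 ⊗ₜ[ℤ] p.2) = ∑ p : S, g p.1.1 p.1.2 := by
      rw [Finset.sum_coe_sort S fun p => g p.1 p.2, map_sum]
      rfl
    rw [h1]
    have h2 : ∀ p : S, g p.1.1 p.1.2 = ∑ c : s, g (c.1 p • p.1.1) (y c) := fun p => by
      have h3 := congrArg (g p.1.1) (hy p)
      rw [map_sum] at h3
      rw [h3]
      exact Finset.sum_congr rfl fun c _ => (DFunLike.congr_fun (map_smul g (c.1 p) p.1.1) (y c)).symm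
    rw [Finset.sum_congr rfl fun p _ => h2 p, Finset.sum_comm]
    refine Finset.sum_eq_zero fun c _ => ?_
    have h4 : ∑ p : S, c.1 p • p.1.1 = 0 := by
      apply Subtype.ext
      have := hs c.1 c.2
      apply MulOpposite.unop_injective
      simpa using this
    rw [← LeftCharacter.sum_apply, ← map_sum, h4, map_zero]
    rfl
  obtain ⟨ψ, hψ⟩ := exists_character_comp_eq μ.toAddMonoidHom φ.toAddMonoidHom hker
  refine ⟨LinearMap.toSpanSingleton Rᵐᵒᵖ _ (ψ : LeftCharacter R (RightCharacter R E)),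
    fun x hx => LeftCharacter.ext fun m => hψ (⟨x, hx⟩ ⊗ₜ[ℤ] m)⟩

end Characters

/-! ### Dimension shifting for the cohomology of `Hom(C, -)` -/

section HomCohomology

variable {A : Type*} [Category* A] [Abelian A]

/-- The morphism `g` induces zero on the cohomology of the complexes `Hom(C, -)`. -/
def IsHomCohomologyNull (C : ChainComplex A ℤ) {M N : A} (g : M ⟶ N) : Prop :=
  ∀ i j k : ℤ, i + 1 = j → j + 1 = k → ∀ f : C.X j ⟶ M, C.d k j ≫ f = 0 →
    ∃ h : C.X i ⟶ N, C.d j i ≫ h = f ≫ g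

variable {C : ChainComplex A ℤ}

theorem IsHomCohomologyNull.comp {M N L : A} {g : N ⟶ L} (hg : IsHomCohomologyNull C g)
    (u : M ⟶ N) : IsHomCohomologyNull C (u ≫ g) := fun i j k hij hjk f hf => by
  obtain ⟨h, hh⟩ := hg i j k hij hjk (f ≫ u) (by rw [← Category.assoc, hf, Limits.zero_comp])
  exact ⟨h, by rw [hh, Category.assoc]⟩

theorem IsHomCohomologyNull.comp_right {M N L : A} {g : M ⟶ N} (hg : IsHomCohomologyNull C g)
    (u : N ⟶ L) : IsHomCohomologyNull C (g ≫ u) := fun i j k hij hjk f hf => by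
  obtain ⟨h, hh⟩ := hg i j k hij hjk f hf
  exact ⟨h ≫ u, by rw [← Category.assoc, hh, Category.assoc]⟩

/-- If a map of short exact sequences is null on the left, and the middle term of its target is
acyclic, then it is null on the right. -/
theorem IsHomCohomologyNull.of_shortExact (hC : ∀ i, Projective (C.X i)) {S T : ShortComplex A}
    (hS : S.ShortExact) (hT : T.ShortExact) (φ : S ⟶ T) (h₁ : IsHomCohomologyNull C φ.τ₁)
    (h₂ : IsHomCohomologyNull C (𝟙 T.X₂)) : IsHomCohomologyNull C φ.τ₃ := by
  intro i j k hij hjk f hf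
  have := hS.mono_f
  have := hS.epi_g
  have := hT.mono_f
  let p := Projective.factorThru f S.g
  have hp : p ≫ S.g = f := Projective.factorThru_comp _ _
  -- `q` represents the connecting image of `f`. Since `φ.τ₁` kills its class, `p ≫ φ.τ₂` can be
  -- corrected to a cocycle in `T.X₂`. Acyclicity of `S.X₂` is not needed.
  let q := hS.exact.lift (C.d k j ≫ p) (by rw [Category.assoc, hp, hf])
  have hq : q ≫ S.f = C.d k j ≫ p := hS.exact.lift_f _ _
  obtain ⟨h, hh⟩ := h₁ j k (k + 1) hjk rfl q (by
    rw [← cancel_mono S.f, Category.assoc, hq, ← Category.assoc, C.d_comp_d, Limits.zero_comp,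
      Limits.zero_comp])
  obtain ⟨h', hh'⟩ := h₂ i j k hij hjk (p ≫ φ.τ₂ - h ≫ T.f) (by
    rw [Preadditive.comp_sub, ← Category.assoc, ← Category.assoc, hh, ← hq, Category.assoc,
      Category.assoc, φ.comm₁₂, sub_self])
  refine ⟨h' ≫ T.g, ?_⟩
  rw [← Category.assoc, hh', Category.comp_id, Preadditive.sub_comp, Category.assoc, Category.assoc,
    T.zero, Limits.comp_zero, sub_zero, φ.comm₂₃, ← Category.assoc, hp]

/-- If the middle and right terms of a short exact sequence are acyclic, so is the left term. -/
theorem IsHomCohomologyNull.left_of_shortExact (hC : ∀ i, Projective (C.X i)) {S : ShortComplex A}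
    (hS : S.ShortExact) (h₂ : IsHomCohomologyNull C (𝟙 S.X₂))
    (h₃ : IsHomCohomologyNull C (𝟙 S.X₃)) : IsHomCohomologyNull C (𝟙 S.X₁) := by
  intro i j k hij hjk f hf
  have := hS.mono_f
  have := hS.epi_g
  obtain ⟨h, hh⟩ := h₂ i j k hij hjk (f ≫ S.f) (by rw [← Category.assoc, hf, Limits.zero_comp])
  rw [Category.comp_id] at hh
  -- `h` need not land in `S.X₁`, but its image in `S.X₃` is a cocycle; subtracting a lifted
  -- coboundary fixes this without changing `C.d j i ≫ h`.
  obtain ⟨h', hh'⟩ := h₃ (i - 1) i j (by ring) hij (h ≫ S.g) (by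
    rw [← Category.assoc, hh, Category.assoc, S.zero, Limits.comp_zero])
  rw [Category.comp_id] at hh'
  let p := Projective.factorThru h' S.g
  have hp : p ≫ S.g = h' := Projective.factorThru_comp _ _
  let q := hS.exact.lift (h - C.d i (i - 1) ≫ p) (by
    rw [Preadditive.sub_comp, Category.assoc, hp, hh', sub_self])
  have hq : q ≫ S.f = h - C.d i (i - 1) ≫ p := hS.exact.lift_f _ _
  refine ⟨q, ?_⟩
  rw [← cancel_mono S.f, Category.assoc, hq, Preadditive.comp_sub, hh, ← Category.assoc,
    C.d_comp_d, Limits.zero_comp, sub_zero, Category.comp_id]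

/-- In a coresolution `X 0 → F 0 → F 1 → ⋯` with cosyzygies `X m` and terms `F m` acyclic for
`Hom(C, -)`, a morphism to `X (m + 1)` from an object of projective dimension at most `m` is null. -/
theorem isHomCohomologyNull_of_hasProjectiveDimensionLE [EnoughProjectives A]
    (hC : ∀ i, Projective (C.X i)) (X F : ℕ → A) (ι : ∀ m, X m ⟶ F m) (π : ∀ m, F m ⟶ X (m + 1))
    (w : ∀ m, ι m ≫ π m = 0) (hX : ∀ m, (ShortComplex.mk (ι m) (π m) (w m)).ShortExact)
    (hF : ∀ m, IsHomCohomologyNull C (𝟙 (F m))) (m : ℕ) :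
    ∀ (M : A) (_ : HasProjectiveDimensionLE M m) (g : M ⟶ X (m + 1)), IsHomCohomologyNull C g := by
  induction m with
  | zero =>
    -- The projective `M` lifts along `F 0 → X 1`; hence the target index is one more than the
    -- dimension bound.
    intro M hM g
    have := (projective_iff_hasProjectiveDimensionLE_zero M).2 hM
    have := (hX 0).epi_g
    have hg : Projective.factorThru g (π 0) ≫ π 0 = g := Projective.factorThru_comp _ _
    have h := ((hF 0).comp (Projective.factorThru g (π 0))).comp_right (π 0)
    rwa [Category.comp_id, hg] at h
  | succ m ih =>
    intro M hM g
    have := (hX (m + 1)).epi_g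
    have := (hX (m + 1)).mono_f
    let S := ShortComplex.mk (Limits.kernel.ι (Projective.π M)) (Projective.π M)
      (Limits.kernel.condition _)
    have hS : S.ShortExact := { exact := ShortComplex.exact_kernel _ }
    -- Lift `g` to a map from the syzygy sequence of `M`; the syzygy has projective dimension at
    -- most `m`, so `ih` applies to `a`.
    let b : S.X₂ ⟶ F (m + 1) := Projective.factorThru (Projective.π M ≫ g) (π (m + 1))
    have hb : b ≫ π (m + 1) = S.g ≫ g := Projective.factorThru_comp _ _
    let a : S.X₁ ⟶ X (m + 1) := (hX (m + 1)).exact.lift (S.f ≫ b) (by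
      change (S.f ≫ b) ≫ π (m + 1) = 0
      rw [Category.assoc, hb, ← Category.assoc, S.zero, Limits.zero_comp])
    have ha : a ≫ ι (m + 1) = S.f ≫ b := (hX (m + 1)).exact.lift_f _ _
    let φ : S ⟶ ShortComplex.mk (ι (m + 1)) (π (m + 1)) (w (m + 1)) := ⟨a, b, g, ha, hb⟩
    exact IsHomCohomologyNull.of_shortExact hC hS (hX (m + 1)) φ
      (ih _ ((hS.hasProjectiveDimensionLT_X₃_iff m (Projective.projective_over M)).1 hM) a)
      (hF (m + 1))

/-- If the cosyzygies of a coresolution by objects acyclic for `Hom(C, -)` have bounded projective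
dimension, then they are acyclic for `Hom(C, -)`. -/
theorem isHomCohomologyNull_of_coresolution [EnoughProjectives A]
    (hC : ∀ i, Projective (C.X i)) (X F : ℕ → A) (ι : ∀ m, X m ⟶ F m) (π : ∀ m, F m ⟶ X (m + 1))
    (w : ∀ m, ι m ≫ π m = 0) (hX : ∀ m, (ShortComplex.mk (ι m) (π m) (w m)).ShortExact)
    (hF : ∀ m, IsHomCohomologyNull C (𝟙 (F m))) (n : ℕ)
    (hn : HasProjectiveDimensionLE (X (n + 1)) n) : IsHomCohomologyNull C (𝟙 (X 0)) :=
  Nat.decreasingInduction (motive := fun m _ => IsHomCohomologyNull C (𝟙 (X m)))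
    (fun m _ h => IsHomCohomologyNull.left_of_shortExact hC (hX m) (hF m) h)
    (isHomCohomologyNull_of_hasProjectiveDimensionLE hC X F ι π w hX hF n _ hn (𝟙 _))
    (Nat.zero_le (n + 1))

end HomCohomology

/-! ### The double character coresolution and the theorem -/

section Modules

variable {R : Type u} [Ring R] {C : ChainComplex (ModuleCat.{u} R) ℤ}

theorem homComplex_acyclic_of_isHomCohomologyNull {P : ModuleCat.{u} R}
    (h : IsHomCohomologyNull C (𝟙 P)) : (homComplex C P).Acyclic := by
  intro j
  rw [HomologicalComplex.exactAt_iff' _ (j - 1) j (j + 1) (ComplexShape.prev_eq' _ (by simp))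
    (ComplexShape.next_eq' _ (by simp)), ShortComplex.ab_exact_iff]
  intro f hf
  obtain ⟨g, hg⟩ := h (j - 1) j (j + 1) (by ring) rfl f hf
  exact ⟨g, hg.trans (Category.comp_id _)⟩

/-- `Hom(C, E⁺)` is dual to `E ⊗ C`. -/
theorem isHomCohomologyNull_rightCharacter (E : Type u) [AddCommGroup E] [Module Rᵐᵒᵖ E]
    (h : (tensorComplex E C).Acyclic) :
    IsHomCohomologyNull C (𝟙 (ModuleCat.of R (RightCharacter R E))) := by
  intro i j k hij hjk f hf
  have hex := h j
  rw [HomologicalComplex.exactAt_iff' _ k j i (ComplexShape.prev_eq' _ (by simpa))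
    (ComplexShape.next_eq' _ (by simpa)), ShortComplex.moduleCat_exact_iff] at hex
  let d (a b : ℤ) : BalancedTensor R E (C.X a) →ₗ[ℤ] BalancedTensor R E (C.X b) :=
    BalancedTensor.map R LinearMap.id (C.d a b).hom
  have hkill : ∀ y, BalancedTensor.character f.hom (d k j y) = 0 := by
    have : (BalancedTensor.character f.hom).toIntLinearMap.comp (d k j) = 0 := by
      refine Submodule.linearMap_qext _ (TensorProduct.ext' fun e c => ?_)
      exact DFunLike.congr_fun (LinearMap.congr_fun (congrArg ModuleCat.Hom.hom hf) c) e
    exact LinearMap.congr_fun this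
  -- The character of `E ⊗ C_j` given by the cocycle `f` kills boundaries, hence all cycles by
  -- exactness, so it extends along `d j i`.
  obtain ⟨ψ, hψ⟩ := exists_character_comp_eq (d j i).toAddMonoidHom
    (BalancedTensor.character f.hom) fun x hx => by
      obtain ⟨y, rfl⟩ := hex x hx
      exact hkill y
  refine ⟨ModuleCat.ofHom (BalancedTensor.curry ψ), ModuleCat.hom_ext (LinearMap.ext fun c =>
    RightCharacter.ext (R := R) (E := E) fun e => ?_)⟩
  exact hψ (Submodule.Quotient.mk (e ⊗ₜ[ℤ] c))

/-- The cokernel of the embedding of a module into its double character module. -/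
abbrev doubleCharacterCokernel (M : ModuleCat.{u} R) : ModuleCat.{u} R :=
  ModuleCat.of R (RightCharacter R (LeftCharacter R M) ⧸ LinearMap.range (LeftCharacter.eval R M))

theorem doubleCharacterCokernel_shortExact (M : ModuleCat.{u} R) :
    (ShortComplex.mk (ModuleCat.ofHom (LeftCharacter.eval R M))
      (ModuleCat.ofHom (LinearMap.range (LeftCharacter.eval R M)).mkQ :
        _ ⟶ doubleCharacterCokernel M)
      (ModuleCat.hom_ext (LinearMap.range_mkQ_comp _))).ShortExact :=
  ModuleCat.shortComplex_shortExact _ (LinearMap.exact_map_mkQ_range _)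
    LeftCharacter.eval_injective (Submodule.mkQ_surjective _)

/-- The modules obtained from `M` by iterating the cokernel of the embedding into the double
character module. -/
def iteratedDoubleCharacterCokernel (M : ModuleCat.{u} R) : ℕ → ModuleCat.{u} R
  | 0 => M
  | m + 1 => doubleCharacterCokernel (iteratedDoubleCharacterCokernel M m)

/-- This invariant serves twice: it makes each double character module acyclic for `Hom(C, -)`, and
it makes each cosyzygy flat. -/
theorem injective_leftCharacter_iteratedDoubleCharacterCokernel (hcoh : IsRightCoherent R)
    (M : ModuleCat.{u} R) [Module.Projective R M] (m : ℕ) :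
    Module.Injective Rᵐᵒᵖ (LeftCharacter R (iteratedDoubleCharacterCokernel M m)) := by
  induction m with
  | zero => exact injective_leftCharacter_of_projective (R := R) (M := M)
  | succ m ih =>
    exact injective_leftCharacter_quotient_eval (injective_leftCharacter_rightCharacter hcoh ih)

end Modules

theorem corollary1 (R : Type u) [Ring R] (n : ℕ) (hcoh : IsRightCoherent R)
    (hperf : IsLeftNPerfect R n) (C : ChainComplex (ModuleCat.{u} R) ℤ)
    (hproj : ∀ i : ℤ, Module.Projective R (C.X i)) (hC : IsNTotallyAcyclic C) :
    IsTotallyAcyclic C := by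
  refine ⟨hproj, hC.exact, fun P hP => homComplex_acyclic_of_isHomCohomologyNull ?_⟩
  let X := iteratedDoubleCharacterCokernel P
  have hX := injective_leftCharacter_iteratedDoubleCharacterCokernel hcoh P
  exact isHomCohomologyNull_of_coresolution
    (fun i => (IsProjective.iff_projective (C.X i)).1 (hproj i)) X
    (fun m => ModuleCat.of R (RightCharacter R (LeftCharacter R (X m)))) _ _ _
    (fun m => doubleCharacterCokernel_shortExact (X m))
    (fun m => isHomCohomologyNull_rightCharacter _ (hC.tensor_exact _ (hX m))) n
    (hperf _ (isFlatModule_of_injective_leftCharacter (hX (n + 1))))
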